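/- **Setting.** A problem instance $(\mathbf U,\mathbf A,\mathbf W)$ of the latent contextual bandit has observed contexts $\mathcal S=[L]$ with law $(\beta_s)$, $K\ge 2$ arms, and latent contexts $z_1,\dots,z_m\in\mathcal S$ (distinct). $\mathbf A=(\alpha_{si})$ is an $L\times m$ matrix with nonnegative entries and row sums $1$ (the posterior of the latent context given $s$) with $\alpha_{z_i j}=\mathbf 1\{i=j\}$. $\mathbf W\in[0,1]^{m\times K}$, $\mathbf U=\mathbf A\mathbf W$, and for each $s$ the best arm $k^*(s)=\arg\max_k U_{sk}$ is unique. Write $u^*(s)=\max_k U_{sk}$, $\Delta(s)=\min_{k\ne k^*(s)}(u^*(s)-U_{sk})$, $\Delta=\min_s\Delta(s)$, $U_{\max}=\max_{s,k}U_{sk}$ and $\mathcal C(z_i)=\{s:\alpha_{si}\neq 0\}$. In round $t$ a context $S_t$ is drawn independently from $\beta$; a (possibly randomized) policy, knowing the past contexts, arms and rewards and $S_t$, chooses an arm $X_t$ and receives a reward $Y_t\sim\mathrm{Ber}(U_{S_t,X_t})$. The regret is $R(T)=\mathbb E\sum_{t=1}^T\big(u^*(S_t)-Y_t\big)$. For $\alpha\in(0,1)$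 and constants $C_0,\tau_0$, say that a policy satisfies the *consistency bound with constants $(C_0,\tau_0)$* in an instance if, conditionally on any context sequence $S_1,\dots,S_T$ of any length, for every $s$ and every $k\neq k^*(s)$, $$\mathbb E\Big[\sum_{t\le T:\,S_t=s}\mathbf 1\{X_t=k\}\Big]\le C_0\,T(s)^{\alpha}\quad\text{whenever } T(s):=\sum_{t\le T}\mathbf 1\{S_t=s\}\ge\tau_0 .$$ A policy is *$\alpha$-consistent* if in every problem instance (with the same $L,K,m$) it satisfies this bound with some constants, which may depend on the instance. Put $\lambda=(U_{\max}+1)/2$ and, with $\mathrm{KL}(p,q)$ the Kullback–Leibler divergence between $\mathrm{Ber}(p)$ and $\mathrm{Ber}(q)$ (and $x/\infty=0$), $$D(\mathbf U)=\min_{i\in[m]}\ \min_{k\neq k^*(z_i)}\frac{\Delta(z_i)}{\mathrm{KL}(U_{z_ik},\lambda)} .$$ **Theorem (Lower Bound).** Call an instance *clustered* if $\beta_s=1/L$ for all $s$, $m$ divides $L$, $|\mathcal C(z_i)|=L/m$ for all $i$, and the sets $\mathcal C(z_i)$ are pairwise disjoint. 1. There is a constant $d>0$ such that for all $L,m\ge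 1$ and $K\ge 2$ with $m\mid L$ there is a clustered instance with $D(\mathbf U)=d$. 2. $D(\mathbf U)=O(1/\Delta)$: there is an absolute constant $c$ with $D(\mathbf U)\le c/\Delta$ for every clustered instance; moreover $D(\mathbf U)>0$ if $U_{\max}<1$. 3. For every clustered instance, every $\alpha\in(0,1)$ and every $\alpha$-consistent policy there are constants $C>0$ and $\tau\ge0$ such that for all $T>\tau$ $$R(T)\ \ge\ (K-1)\,m\,D(\mathbf U)\Big((1-\alpha)\big(\log\tfrac{T}{2m}-\log\tfrac{L}{m}\big)-\log(4KC)\Big).$$ 4. The constants $C,\tau$ depend only on the constants of the consistency bound: for all $C_0,\tau_0$ there are $C>0$, $\tau\ge 0$ such that, for all $L,K,m$, every clustered instance and every $\alpha\in(0,1)$, the inequality in 3 holds for all $T>\tau$ and for every policy that satisfies the consistency bound with constants $(C_0,\tau_0)$ in that instance and in every instance obtained from it by replacing one entry $W_{ik}$, $k\ne k^*(z_i)$, of $\mathbf W$ by $\lambda$. -/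

import Mathlib

open scoped BigOperators

noncomputable section

namespace LatentBandit

/-- A problem instance of the latent contextual bandit with `L` observed contexts, `K` arms and
`m` latent contexts.  Arms and contexts are indexed by `Fin`.  `β` is the law of the observed
context, `z` embeds the latent contexts among the observed ones, `A s i = P(Z = z i | S = s)`,
and `W i k` is the mean reward of arm `k` in the latent context `z i`.  In every observed context
the best arm is unique (the gap is positive). -/
structure Instance (L K m : ℕ) where
  β : Fin L → ℝ
  β_nonneg : ∀ s, 0 ≤ β s
  β_sum : ∑ s, β s = 1
  z : Fin m ↪ Fin L
  A : Matrix (Fin L) (Fin m) ℝ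
  A_nonneg : ∀ s i, 0 ≤ A s i
  A_sum : ∀ s, ∑ i, A s i = 1
  A_latent : ∀ i j, A (z i) j = if i = j then 1 else 0
  W : Matrix (Fin m) (Fin K) ℝ
  W_mem : ∀ i k, W i k ∈ Set.Icc (0 : ℝ) 1
  exists_best : ∀ s, ∃ k, ∀ j, j ≠ k → (A * W) s j < (A * W) s k

namespace Instance

variable {L K m : ℕ} (I : Instance L K m)

/-- The `L × K` matrix of mean rewards, `U = A W`. -/
def U : Matrix (Fin L) (Fin K) ℝ := I.A * I.W

theorem U_mem (s : Fin L) (k : Fin K) : I.U s k ∈ Set.Icc (0 : ℝ) 1 := by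
  unfold U
  rw [Matrix.mul_apply]
  refine ⟨Finset.sum_nonneg fun i _ => mul_nonneg (I.A_nonneg s i) (I.W_mem i k).1, ?_⟩
  calc ∑ i, I.A s i * I.W i k ≤ ∑ i, I.A s i :=
        Finset.sum_le_sum fun i _ => mul_le_of_le_one_right (I.A_nonneg s i) (I.W_mem i k).2
    _ = 1 := I.A_sum s

/-- The best arm `k*(s)` in the context `s`. -/
def bestArm (s : Fin L) : Fin K := (I.exists_best s).choose

/-- The mean reward `u*(s)` of the best arm in the context `s`. -/
def bestMean (s : Fin L) : ℝ := I.U s (I.bestArm s)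

/-- The gap between the best and the second best mean reward in the context `s`. -/
def gapAt (s : Fin L) : ℝ := ⨅ k : {k : Fin K // k ≠ I.bestArm s}, (I.bestMean s - I.U s k)

/-- The gap `Δ`, the minimum of the gaps of all observed contexts. -/
def gap : ℝ := ⨅ s, I.gapAt s

/-- The largest mean reward, `U_max`. -/
def Umax : ℝ := ⨆ s, ⨆ k, I.U s k

/-- The level `λ = (U_max + 1) / 2`. -/
def lam : ℝ := (I.Umax + 1) / 2

theorem lam_mem : I.lam ∈ Set.Icc (0 : ℝ) 1 := by
  have h0 : 0 ≤ I.Umax := Real.iSup_nonneg fun s => Real.iSup_nonneg fun k => (I.U_mem s k).1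
  have h1 : I.Umax ≤ 1 :=
    Real.iSup_le (fun s => Real.iSup_le (fun k => (I.U_mem s k).2) zero_le_one) zero_le_one
  unfold lam
  constructor <;> linarith

/-- The Kullback–Leibler divergence `KL(Ber(U s k) ‖ Ber(λ))`, possibly infinite. -/
def klToLam (s : Fin L) (k : Fin K) : ENNReal :=
  InformationTheory.klDiv (ProbabilityTheory.bernoulliMeasure true false ⟨I.U s k, I.U_mem s k⟩)
    (ProbabilityTheory.bernoulliMeasure true false ⟨I.lam, I.lam_mem⟩)

/-- The constant `D(U)`: the minimum, over the latent contexts `z i` and the arms `k` that are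
suboptimal there, of `Δ(z i) / KL(Ber(U (z i) k) ‖ Ber(λ))` (so `0` where the divergence is
infinite, which happens only if `λ = 1`). -/
def D : ℝ := ⨅ i : Fin m, ⨅ k : {k : Fin K // k ≠ I.bestArm (I.z i)},
  (ENNReal.ofReal (I.gapAt (I.z i)) / I.klToLam (I.z i) k).toReal

/-- The set of observed contexts in which the latent context `z i` has nonzero probability. -/
def cluster (i : Fin m) : Set (Fin L) := {s | I.A s i ≠ 0}

/-- Observed contexts are uniformly distributed, and the clusters of the latent contexts are
pairwise disjoint and have `L / m` elements each. -/
structure IsClustered : Prop where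
  uniform : ∀ s, I.β s = 1 / (L : ℝ)
  dvd : m ∣ L
  card_cluster : ∀ i, (I.cluster i).ncard = L / m
  disjoint : ∀ i j, i ≠ j → Disjoint (I.cluster i) (I.cluster j)

/-- `I.IsRaise J`: the instance `J` arises from `I` by setting one entry of `W`, at an arm that is
suboptimal in the latent context concerned, to `λ = (U_max + 1) / 2` (with `U_max` that of `I`). -/
def IsRaise (J : Instance L K m) : Prop :=
  J.β = I.β ∧ J.z = I.z ∧ J.A = I.A ∧
    ∃ i k, k ≠ I.bestArm (I.z i) ∧
      ∀ i' k', J.W i' k' = if i' = i ∧ k' = k then I.lam else I.W i' k'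

end Instance

/-- What is seen in one round: the context, the chosen arm, and the Bernoulli reward. -/
abbrev Round (L K : ℕ) := Fin L × Fin K × Bool

/-- A randomized policy: `prob t h s k` is the probability of choosing arm `k` in round `t` (rounds
are numbered from `0`), given the `t` past rounds `h` and the present context `s`. -/
structure Policy (L K : ℕ) where
  prob : (t : ℕ) → (Fin t → Round L K) → Fin L → Fin K → ℝ
  prob_nonneg : ∀ t h s k, 0 ≤ prob t h s k
  prob_sum : ∀ t h s, ∑ k, prob t h s k = 1

namespace Policy

variable {L K m : ℕ} (π : Policy L K) (I : Instance L K m)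

/-- The conditional probability of the arms and the rewards in the history `h` of `T` rounds, given
the contexts in `h`: the policy chooses the arms, and rewards are Bernoulli with means `U`. -/
def pathProb {T : ℕ} (h : Fin T → Round L K) : ℝ :=
  ∏ t : Fin T,
    π.prob t (fun r => h (Fin.castLE t.isLt.le r)) (h t).1 (h t).2.1 *
      (if (h t).2.2 = true then I.U (h t).1 (h t).2.1 else 1 - I.U (h t).1 (h t).2.1)

/-- The history with contexts `σ` and with arms and rewards `x`. -/
def mkHist {T : ℕ} (σ : Fin T → Fin L) (x : Fin T → Fin K × Bool) : Fin T → Round L K :=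
  fun t => (σ t, x t)

/-- Conditional expectation of a function of the history, given the context sequence `σ`. -/
def condExp {T : ℕ} (σ : Fin T → Fin L) (f : (Fin T → Round L K) → ℝ) : ℝ :=
  ∑ x : Fin T → Fin K × Bool, π.pathProb I (mkHist σ x) * f (mkHist σ x)

/-- Expectation of a function of the history of `T` rounds; contexts are i.i.d. with law `β`. -/
def expect {T : ℕ} (f : (Fin T → Round L K) → ℝ) : ℝ :=
  ∑ σ : Fin T → Fin L, (∏ t, I.β (σ t)) * π.condExp I σ f

/-- The number of rounds in which the context is `s` and arm `k` is chosen. -/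
def pulls {T : ℕ} (s : Fin L) (k : Fin K) (h : Fin T → Round L K) : ℝ :=
  ∑ t : Fin T, if (h t).1 = s ∧ (h t).2.1 = k then 1 else 0

/-- The number `T(s)` of rounds in which the context is `s`. -/
def visits {T : ℕ} (σ : Fin T → Fin L) (s : Fin L) : ℝ :=
  ∑ t : Fin T, if σ t = s then 1 else 0

/-- The (pseudo-)regret `R(T)`: the expectation of `∑ t, (u*(S t) - Y t)`. -/
def regret (T : ℕ) : ℝ :=
  π.expect I (T := T) fun h =>
    ∑ t : Fin T, (I.bestMean (h t).1 - if (h t).2.2 = true then 1 else 0)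

/-- In the instance `I`, given any context sequence of any length `T`, each arm `k ≠ k*(s)` is
chosen in context `s` at most `C * T(s) ^ α` times in expectation, as soon as `τ ≤ T(s)`. -/
def ConsistentAt (α C τ : ℝ) : Prop :=
  ∀ (T : ℕ) (σ : Fin T → Fin L) (s : Fin L) (k : Fin K), k ≠ I.bestArm s → τ ≤ visits σ s →
    π.condExp I σ (pulls s k) ≤ C * visits σ s ^ α

/-- `α`-consistency: in every instance the expected number of pulls of each suboptimal arm in each
context `s` is `O(T(s) ^ α)`; the implicit constants may depend on the instance. -/
def IsConsistent (m : ℕ) (α : ℝ) : Prop :=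
  ∀ J : Instance L K m, ∃ C τ : ℝ, π.ConsistentAt J α C τ

end Policy

end LatentBandit

end

noncomputable section

namespace LatentBandit

open MeasureTheory InformationTheory ProbabilityTheory

/-! The lower bound is a change of measure. Raise one suboptimal entry `W i k` to `λ`. In a
clustered instance this alters the means only for arm `k` on the cluster of `z i`, where `k` becomes
the best arm. Given the contexts, the divergence of the two path laws is therefore the expected
number of pulls of `k` in that cluster times `KL(W i k, λ)`. Consistency in both instances makes the
fraction of visits to `z i` at which `k` is pulled a good test between them. By the
Bretagnolle–Huber inequality the divergence must be large (`Policy.log_visits_le_clusterPulls`):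
with `V` visits to `z i` it is at least `(1 - α) log V` minus a constant.

A pull of `k` in the cluster costs at least `gapAt (z i) ≥ D * KL`, so the divergence cancels and
each of the `m (K - 1)` pairs contributes `D` times the logarithm
(`Policy.sum_visits_le_condExp_regret`). By a Chernoff bound `V ≥ T / (2L)` with high probability,
and the exceptional event costs an additive constant inside the bracket
(`Policy.regret_lower_bound`). If `Umax = 1` then `D = 0` and nothing is to be shown.

The bound `D ≤ 2 / gap` is a weak Pinsker inequality combined with `λ ≥ u*(z i)`. -/

/-! ### Kullback–Leibler divergence of Bernoulli laws -/

theorem rnDeriv_eq_div_of_ac (μ ν : Measure Bool) [IsFiniteMeasure μ] [IsFiniteMeasure ν]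
    (h : μ ≪ ν) (b : Bool) (hb : ν {b} ≠ 0) : (μ.rnDeriv ν b).toReal = μ.real {b} / ν.real {b} := by
  have h1 : ∫⁻ x in {b}, μ.rnDeriv ν x ∂ν = μ {b} := Measure.setLIntegral_rnDeriv h _
  rw [lintegral_singleton] at h1
  have h2 : ν.real {b} ≠ 0 := by simpa [measureReal_def, ENNReal.toReal_eq_zero_iff] using hb
  rw [eq_div_iff h2, measureReal_def, measureReal_def, ← h1, ENNReal.toReal_mul]

/-- The Kullback–Leibler divergence of Bernoulli laws, as a real number. -/
def bernKL (p q : ℝ) : ℝ := p * Real.log (p / q) + (1 - p) * Real.log ((1 - p) / (1 - q))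

theorem bernoulli_ac {p q : ℝ} (hp : p ∈ Set.Icc (0 : ℝ) 1) (hq : q ∈ Set.Icc (0 : ℝ) 1)
    (h0 : 0 < q) (h1 : q < 1) :
    bernoulliMeasure true false ⟨p, hp⟩ ≪ bernoulliMeasure true false ⟨q, hq⟩ := by
  classical
  intro s hs
  rw [bernoulliMeasure_apply _ (MeasurableSet.of_discrete)] at hs ⊢
  have hq1 : (1 - q) ≠ 0 := by linarith
  have e1 : (unitInterval.toNNReal ⟨q, hq⟩) ≠ 0 := by
    simpa [← NNReal.coe_ne_zero] using h0.ne'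
  have e2 : (unitInterval.toNNReal (unitInterval.symm ⟨q, hq⟩)) ≠ 0 := by
    simpa [← NNReal.coe_ne_zero] using hq1
  split_ifs at hs ⊢ <;> simp_all

theorem toReal_klDiv_bernoulli {p q : ℝ} (hp : p ∈ Set.Icc (0 : ℝ) 1)
    (hq : q ∈ Set.Icc (0 : ℝ) 1) (h0 : 0 < q) (h1 : q < 1) :
    (klDiv (bernoulliMeasure true false ⟨p, hp⟩)
      (bernoulliMeasure true false ⟨q, hq⟩)).toReal = bernKL p q := by
  have hac := bernoulli_ac hp hq h0 h1
  have hq1 : (1 - q) ≠ 0 := by linarith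
  rw [toReal_klDiv_of_measure_eq hac (by simp), integral_bernoulliMeasure]
  have e1 : (bernoulliMeasure true false (⟨q, hq⟩ : unitInterval)).real {true} = q := by simp
  have e2 : (bernoulliMeasure true false (⟨q, hq⟩ : unitInterval)).real {false} = 1 - q := by simp
  rw [llr, llr, rnDeriv_eq_div_of_ac _ _ hac, rnDeriv_eq_div_of_ac _ _ hac, e1, e2]
  · simp [bernKL]
  · intro h; rw [measureReal_def, h] at e2; simp at e2; exact hq1 e2.symm
  · intro h; rw [measureReal_def, h] at e1; simp at e1; exact h0.ne e1

/-- The first law charges `false` and the second does not, so absolute continuity fails. -/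
theorem klDiv_bernoulli_one {p q : ℝ} (hp : p ∈ Set.Icc (0 : ℝ) 1)
    (hq : q ∈ Set.Icc (0 : ℝ) 1) (hp1 : p < 1) (hq1 : q = 1) :
    klDiv (bernoulliMeasure true false ⟨p, hp⟩) (bernoulliMeasure true false ⟨q, hq⟩) = ⊤ := by
  apply klDiv_of_not_ac
  intro h
  have h2 : bernoulliMeasure true false (⟨p, hp⟩ : unitInterval) {false} = 0 := by
    apply h
    subst hq1
    rw [show (⟨1, hq⟩ : unitInterval) = 1 from rfl]
    simp
  have h3 : (bernoulliMeasure true false (⟨p, hp⟩ : unitInterval)).real {false} = 1 - p := by simp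
  rw [measureReal_def, h2] at h3
  simp at h3
  linarith

/-- This is `log x ≤ x - 1` at `x = √(b / a)`. Added over the two outcomes it bounds the divergence
below by a squared Hellinger distance. -/
theorem two_mul_sub_sqrt_le_mul_log {a b : ℝ} (ha : 0 ≤ a) (hb : 0 < b) :
    2 * a - 2 * √(a * b) ≤ a * Real.log (a / b) := by
  rcases ha.eq_or_lt with rfl | ha
  · simp
  have h := Real.log_le_sub_one_of_pos (x := √(b / a)) (by positivity)
  rw [Real.log_sqrt (by positivity)] at h
  have h1 : Real.log (a / b) = - Real.log (b / a) := by rw [← Real.log_inv, inv_div]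
  have h2 : √(a * b) = a * √(b / a) := by
    rw [show a * b = a ^ 2 * (b / a) by field_simp, Real.sqrt_mul (by positivity),
      Real.sqrt_sq ha.le]
  rw [h1, h2]
  nlinarith

/-- The right side is `(√a - √b)²`, and `(√a + √b)² ≤ 4`. -/
theorem sq_sub_le_sub_sqrt {a b : ℝ} (ha : 0 ≤ a) (hb : 0 ≤ b) (ha1 : a ≤ 1) (hb1 : b ≤ 1) :
    (a - b) ^ 2 / 4 ≤ a + b - 2 * √(a * b) := by
  rw [Real.sqrt_mul ha]
  have h1 := Real.sq_sqrt ha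
  have h2 := Real.sq_sqrt hb
  have h3 : √a ≤ 1 := Real.sqrt_le_one.2 ha1
  have h4 : √b ≤ 1 := Real.sqrt_le_one.2 hb1
  have h5 := Real.sqrt_nonneg a
  have h6 := Real.sqrt_nonneg b
  set x := √a
  set y := √b
  have h7 : (x + y) ^ 2 ≤ 4 := by nlinarith
  have h8 : (a - b) ^ 2 = (x - y) ^ 2 * (x + y) ^ 2 := by rw [← h1, ← h2]; ring
  have h9 : a + b - 2 * (x * y) = (x - y) ^ 2 := by rw [← h1, ← h2]; ring
  rw [h8, h9]
  nlinarith [mul_le_mul_of_nonneg_left h7 (sq_nonneg (x - y))]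

/-- Pinsker's inequality with a non-optimal constant, through the Hellinger distance. -/
theorem sq_sub_div_two_le_bernKL {p q : ℝ} (hp : p ∈ Set.Icc (0 : ℝ) 1) (h0 : 0 < q)
    (h1 : q < 1) : (p - q) ^ 2 / 2 ≤ bernKL p q := by
  have a1 := two_mul_sub_sqrt_le_mul_log hp.1 h0
  have a2 := two_mul_sub_sqrt_le_mul_log (sub_nonneg.2 hp.2) (sub_pos.2 h1)
  have b1 := sq_sub_le_sub_sqrt hp.1 h0.le hp.2 h1.le
  have b2 := sq_sub_le_sub_sqrt (sub_nonneg.2 hp.2) (sub_pos.2 h1).le (by linarith [hp.1])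
    (by linarith)
  unfold bernKL
  nlinarith

/-! ### Means, gaps and the constant `D` -/

namespace Instance

variable {L K m : ℕ} (I : Instance L K m)

theorem U_lt_bestMean {s : Fin L} {k : Fin K} (hk : k ≠ I.bestArm s) : I.U s k < I.bestMean s :=
  (I.exists_best s).choose_spec k hk

theorem U_le_bestMean (s : Fin L) (k : Fin K) : I.U s k ≤ I.bestMean s := by
  by_cases hk : k = I.bestArm s
  · rw [hk, bestMean]
  · exact (I.U_lt_bestMean hk).le

theorem bestArm_eq {s : Fin L} {k : Fin K} (h : ∀ j, j ≠ k → I.U s j < I.U s k) :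
    I.bestArm s = k := by
  by_contra hne
  exact absurd (h _ hne) (not_lt.2 (I.U_le_bestMean s k))

theorem U_le_Umax (s : Fin L) (k : Fin K) : I.U s k ≤ I.Umax :=
  (le_ciSup (f := fun k => I.U s k) (Set.finite_range _).bddAbove k).trans
    (le_ciSup (f := fun s => ⨆ k, I.U s k) (Set.finite_range _).bddAbove s)

theorem Umax_nonneg : 0 ≤ I.Umax :=
  Real.iSup_nonneg fun s => Real.iSup_nonneg fun k => (I.U_mem s k).1

theorem Umax_le_one : I.Umax ≤ 1 := by
  linarith [I.lam_mem.2, show I.lam = (I.Umax + 1) / 2 from rfl]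

theorem lam_pos : 0 < I.lam := by unfold lam; linarith [I.Umax_nonneg]

theorem lam_lt_one (h : I.Umax < 1) : I.lam < 1 := by unfold lam; linarith

theorem Umax_lt_lam (h : I.Umax < 1) : I.Umax < I.lam := by unfold lam; linarith

theorem Umax_le_lam : I.Umax ≤ I.lam := by unfold lam; linarith [I.Umax_le_one]

theorem L_pos (I : Instance L K m) : 0 < L := by
  rcases Nat.eq_zero_or_pos L with rfl | h
  · simpa using I.β_sum
  · exact h

theorem m_pos (I : Instance L K m) : 0 < m := by
  rcases Nat.eq_zero_or_pos m with rfl | h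
  · simpa using I.A_sum ⟨0, I.L_pos⟩
  · exact h

theorem U_latent (i : Fin m) (k : Fin K) : I.U (I.z i) k = I.W i k := by
  simp [U, Matrix.mul_apply, I.A_latent]

theorem nonempty_suboptimal (hK : 2 ≤ K) (s : Fin L) : Nonempty {k : Fin K // k ≠ I.bestArm s} := by
  have : Nontrivial (Fin K) := Fin.nontrivial_iff_two_le.2 hK
  obtain ⟨k, hk⟩ := exists_ne (I.bestArm s)
  exact ⟨k, hk⟩

theorem gapAt_le {s : Fin L} {k : Fin K} (hk : k ≠ I.bestArm s) :
    I.gapAt s ≤ I.bestMean s - I.U s k :=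
  ciInf_le (f := fun k : {k : Fin K // k ≠ I.bestArm s} => I.bestMean s - I.U s k)
    (Set.finite_range _).bddBelow ⟨k, hk⟩

theorem gapAt_pos (hK : 2 ≤ K) (s : Fin L) : 0 < I.gapAt s := by
  have := I.nonempty_suboptimal hK s
  obtain ⟨k, hk⟩ := exists_eq_ciInf_of_finite
    (f := fun k : {k : Fin K // k ≠ I.bestArm s} => I.bestMean s - I.U s k)
  rw [gapAt, ← hk]
  exact sub_pos.2 (I.U_lt_bestMean k.2)

theorem gapAt_nonneg (s : Fin L) : 0 ≤ I.gapAt s :=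
  Real.iInf_nonneg fun k => sub_nonneg.2 (I.U_le_bestMean s k)

theorem gap_le (s : Fin L) : I.gap ≤ I.gapAt s := ciInf_le (Set.finite_range _).bddBelow s

theorem gap_pos (hK : 2 ≤ K) : 0 < I.gap := by
  have : Nonempty (Fin L) := ⟨⟨0, I.L_pos⟩⟩
  obtain ⟨s, hs⟩ := exists_eq_ciInf_of_finite (f := fun s => I.gapAt s)
  rw [gap, ← hs]
  exact I.gapAt_pos hK s

theorem D_nonneg : 0 ≤ I.D :=
  Real.iInf_nonneg fun _ => Real.iInf_nonneg fun _ => ENNReal.toReal_nonneg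

theorem D_le (i : Fin m) {k : Fin K} (hk : k ≠ I.bestArm (I.z i)) :
    I.D ≤ (ENNReal.ofReal (I.gapAt (I.z i)) / I.klToLam (I.z i) k).toReal :=
  (ciInf_le (f := fun i : Fin m => ⨅ k : {k : Fin K // k ≠ I.bestArm (I.z i)},
    (ENNReal.ofReal (I.gapAt (I.z i)) / I.klToLam (I.z i) k).toReal)
    (Set.finite_range _).bddBelow i).trans
  (ciInf_le (f := fun k : {k : Fin K // k ≠ I.bestArm (I.z i)} =>
    (ENNReal.ofReal (I.gapAt (I.z i)) / I.klToLam (I.z i) k).toReal)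
    (Set.finite_range _).bddBelow ⟨k, hk⟩)

theorem toReal_gap_div_kl (h : I.Umax < 1) (i : Fin m) (k : Fin K) :
    (ENNReal.ofReal (I.gapAt (I.z i)) / I.klToLam (I.z i) k).toReal
      = I.gapAt (I.z i) / bernKL (I.W i k) I.lam := by
  rw [ENNReal.toReal_div, ENNReal.toReal_ofReal (I.gapAt_nonneg _), klToLam,
    toReal_klDiv_bernoulli _ _ I.lam_pos (I.lam_lt_one h), U_latent]

theorem W_le_Umax (i : Fin m) (k : Fin K) : I.W i k ≤ I.Umax :=
  I.U_latent i k ▸ I.U_le_Umax _ _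

theorem bernKL_pos (h : I.Umax < 1) (i : Fin m) (k : Fin K) : 0 < bernKL (I.W i k) I.lam := by
  refine lt_of_lt_of_le ?_ (sq_sub_div_two_le_bernKL (I.W_mem i k) I.lam_pos (I.lam_lt_one h))
  have := (I.W_le_Umax i k).trans_lt (I.Umax_lt_lam h)
  have h2 : I.W i k - I.lam ≠ 0 := by linarith
  positivity

theorem D_mul_bernKL_le (h : I.Umax < 1) (i : Fin m) {k : Fin K} (hk : k ≠ I.bestArm (I.z i)) :
    I.D * bernKL (I.W i k) I.lam ≤ I.gapAt (I.z i) := by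
  have := I.D_le i hk
  rwa [I.toReal_gap_div_kl h, le_div_iff₀ (I.bernKL_pos h i k)] at this

theorem D_pos (hK : 2 ≤ K) (h : I.Umax < 1) : 0 < I.D := by
  have : Nonempty (Fin m) := ⟨⟨0, I.m_pos⟩⟩
  obtain ⟨i, hi⟩ := exists_eq_ciInf_of_finite
    (f := fun i : Fin m => ⨅ k : {k : Fin K // k ≠ I.bestArm (I.z i)},
      (ENNReal.ofReal (I.gapAt (I.z i)) / I.klToLam (I.z i) k).toReal)
  have := I.nonempty_suboptimal hK (I.z i)
  obtain ⟨k, hk⟩ := exists_eq_ciInf_of_finite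
    (f := fun k : {k : Fin K // k ≠ I.bestArm (I.z i)} =>
      (ENNReal.ofReal (I.gapAt (I.z i)) / I.klToLam (I.z i) k).toReal)
  rw [D, ← hi, ← hk, I.toReal_gap_div_kl h]
  exact div_pos (I.gapAt_pos hK _) (I.bernKL_pos h _ _)

/-- Here `λ = 1`, so the divergence from any suboptimal mean is infinite and the quotient vanishes.
-/
theorem D_eq_zero (hK : 2 ≤ K) (h : I.Umax = 1) : I.D = 0 := by
  refine le_antisymm ?_ I.D_nonneg
  obtain ⟨k, hk⟩ := I.nonempty_suboptimal hK (I.z ⟨0, I.m_pos⟩)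
  refine (I.D_le ⟨0, I.m_pos⟩ hk).trans ?_
  rw [klToLam, klDiv_bernoulli_one]
  · simp
  · exact (I.U_lt_bestMean hk).trans_le (I.U_mem _ _).2
  · rw [lam, h]; norm_num

/-- Since `λ` is at least the best mean, `λ - W i k ≥ gapAt (z i)`. Pinsker then makes the
divergence at least `gapAt² / 2`, so a single term of the minimum is already at most `2 / gapAt`. -/
theorem D_le_two_div_gap (hK : 2 ≤ K) : I.D ≤ 2 / I.gap := by
  rcases I.Umax_le_one.eq_or_lt with h | h
  · rw [I.D_eq_zero hK h]
    exact div_nonneg zero_le_two (I.gap_pos hK).le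
  obtain ⟨k, hk⟩ := I.nonempty_suboptimal hK (I.z ⟨0, I.m_pos⟩)
  have h1 := I.D_mul_bernKL_le h ⟨0, I.m_pos⟩ hk
  set i : Fin m := ⟨0, I.m_pos⟩
  have h2 := sq_sub_div_two_le_bernKL (I.W_mem i k) I.lam_pos (I.lam_lt_one h)
  have h3 := I.gapAt_le hk
  have h4 : I.bestMean (I.z i) ≤ I.lam := (I.U_le_Umax _ _).trans I.Umax_le_lam
  rw [I.U_latent] at h3
  have h5 := I.gap_le (I.z i)
  have h6 := I.gap_pos hK
  have hD := I.D_nonneg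
  rw [le_div_iff₀ h6]
  have hg : 0 < I.gapAt (I.z i) := h6.trans_le h5
  have h7 : I.gapAt (I.z i) ^ 2 ≤ (I.W i k - I.lam) ^ 2 := by
    rw [← neg_sq (I.W i k - _)]
    exact pow_le_pow_left₀ hg.le (by linarith) 2
  have h8 : I.D * (I.gapAt (I.z i) ^ 2 / 2) ≤ I.gapAt (I.z i) :=
    (mul_le_mul_of_nonneg_left (by linarith) hD).trans h1
  have h9 : I.D * I.gapAt (I.z i) ≤ 2 := by
    by_contra hc
    push Not at hc
    nlinarith
  exact (mul_le_mul_of_nonneg_left h5 hD).trans h9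

theorem exists_mem_cluster (s : Fin L) : ∃ i, s ∈ I.cluster i := by
  by_contra! h
  have : ∀ i, I.A s i = 0 := fun i => by simpa [cluster] using h i
  simpa [this] using I.A_sum s

theorem z_mem_cluster (i : Fin m) : I.z i ∈ I.cluster i := by simp [cluster, I.A_latent]

end Instance

/-! ### A clustered instance with `D` independent of the dimensions -/

/-- The clustered instance with context set `Fin m × Fin q`, in which the arm `k₀` has mean
reward `1 / 2` and every other arm has mean reward `0` in all contexts. -/
def blockInstance (m q K : ℕ) (hm : 0 < m) (hq : 0 < q) (k₀ : Fin K) : Instance (m * q) K m where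
  β := fun _ => 1 / ((m * q : ℕ) : ℝ)
  β_nonneg := fun _ => by positivity
  β_sum := by
    have : ((m * q : ℕ) : ℝ) ≠ 0 := by positivity
    simp only [Finset.sum_const, Finset.card_univ, Fintype.card_fin, nsmul_eq_mul]
    field_simp
  z := ⟨fun i => finProdFinEquiv (i, ⟨0, hq⟩), fun i j h => by simpa using h⟩
  A := Matrix.of fun s i => if (finProdFinEquiv.symm s).1 = i then 1 else 0
  A_nonneg := fun s i => by simp only [Matrix.of_apply]; split_ifs <;> norm_num
  A_sum := fun s => by simp
  A_latent := fun i j => by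
    change (if (finProdFinEquiv.symm (finProdFinEquiv (i, ⟨0, hq⟩))).1 = j then (1 : ℝ) else 0) = _
    rw [Equiv.symm_apply_apply]
  W := Matrix.of fun _ k => if k = k₀ then 1 / 2 else 0
  W_mem := fun i k => by simp only [Matrix.of_apply]; split_ifs <;> norm_num
  exists_best := fun s => ⟨k₀, fun j hj => by simp [Matrix.mul_apply, hj]⟩

section blockInstance

variable {m q K : ℕ} (hm : 0 < m) (hq : 0 < q) (k₀ : Fin K)

theorem blockInstance_U (s : Fin (m * q)) (k : Fin K) :
    (blockInstance m q K hm hq k₀).U s k = if k = k₀ then 1 / 2 else 0 := by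
  simp [Instance.U, blockInstance, Matrix.mul_apply]

theorem blockInstance_isClustered : (blockInstance m q K hm hq k₀).IsClustered where
  uniform := fun s => rfl
  dvd := dvd_mul_right m q
  card_cluster := fun i => by
    have : (blockInstance m q K hm hq k₀).cluster i
        = Set.range (fun j : Fin q => finProdFinEquiv (i, j)) := by
      ext s
      obtain ⟨⟨a, b⟩, rfl⟩ := finProdFinEquiv.surjective s
      simp only [Instance.cluster, blockInstance, Matrix.of_apply, Set.mem_ofPred_eq,
        Equiv.symm_apply_apply, Set.mem_range, EmbeddingLike.apply_eq_iff_eq, Prod.mk.injEq]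
      by_cases h : a = i
      · simp [h]
      · simp [h, Ne.symm h]
    rw [this, Nat.mul_div_cancel_left _ hm, Set.ncard_range_of_injective]
    · simp
    · intro a b h; simpa using h
  disjoint := fun i j hij => by
    rw [Set.disjoint_left]
    intro s hi hj
    simp only [Instance.cluster, blockInstance, Matrix.of_apply, Set.mem_ofPred_eq, ne_eq,
      ite_eq_right_iff, one_ne_zero, imp_false, not_not] at hi hj
    exact hij (hi.symm.trans hj)

theorem blockInstance_bestArm (s : Fin (m * q)) :
    (blockInstance m q K hm hq k₀).bestArm s = k₀ :=
  Instance.bestArm_eq _ fun j hj => by simp [blockInstance_U, hj]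

theorem blockInstance_bestMean (s : Fin (m * q)) :
    (blockInstance m q K hm hq k₀).bestMean s = 1 / 2 := by
  rw [Instance.bestMean, blockInstance_bestArm, blockInstance_U, if_pos rfl]

theorem blockInstance_Umax : (blockInstance m q K hm hq k₀).Umax = 1 / 2 := by
  apply le_antisymm
  · refine Real.iSup_le (fun s => Real.iSup_le (fun k => ?_) (by norm_num)) (by norm_num)
    rw [blockInstance_U]; split_ifs <;> norm_num
  · have := Instance.U_le_Umax (blockInstance m q K hm hq k₀) ⟨0, Nat.mul_pos hm hq⟩ k₀
    rwa [blockInstance_U, if_pos rfl] at this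

theorem blockInstance_gapAt (hK : 2 ≤ K) (s : Fin (m * q)) :
    (blockInstance m q K hm hq k₀).gapAt s = 1 / 2 := by
  have := Instance.nonempty_suboptimal (blockInstance m q K hm hq k₀) hK s
  rw [Instance.gapAt, ← ciInf_const (ι := {k // k ≠ (blockInstance m q K hm hq k₀).bestArm s})
    (a := (1 / 2 : ℝ))]
  congr 1
  ext k
  have hk : k.1 ≠ k₀ := fun h => k.2 (h.trans (blockInstance_bestArm hm hq k₀ _).symm)
  rw [blockInstance_bestMean, blockInstance_U, if_neg hk, sub_zero]

theorem blockInstance_D (hK : 2 ≤ K) :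
    (blockInstance m q K hm hq k₀).D = 1 / 2 / bernKL 0 (3 / 4) := by
  have hU := blockInstance_Umax hm hq k₀
  have hm' : Nonempty (Fin m) := ⟨⟨0, hm⟩⟩
  rw [Instance.D, ← ciInf_const (ι := Fin m) (a := 1 / 2 / bernKL 0 (3 / 4))]
  congr 1
  ext i
  have := Instance.nonempty_suboptimal (blockInstance m q K hm hq k₀) hK
    ((blockInstance m q K hm hq k₀).z i)
  rw [← ciInf_const (ι := {k // k ≠ (blockInstance m q K hm hq k₀).bestArm
    ((blockInstance m q K hm hq k₀).z i)}) (a := 1 / 2 / bernKL 0 (3 / 4))]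
  congr 1
  ext k
  have hk : k.1 ≠ k₀ := fun h => k.2 (h.trans (blockInstance_bestArm hm hq k₀ _).symm)
  rw [Instance.toReal_gap_div_kl _ (by rw [hU]; norm_num), blockInstance_gapAt hm hq k₀ hK,
    ← Instance.U_latent, blockInstance_U, if_neg hk, Instance.lam, hU]
  norm_num

end blockInstance

theorem exists_isClustered_D_eq : ∃ d : ℝ, 0 < d ∧ ∀ L K m : ℕ, 0 < L → 2 ≤ K → 0 < m → m ∣ L →
    ∃ I : Instance L K m, I.IsClustered ∧ I.D = d := by
  refine ⟨1 / 2 / bernKL 0 (3 / 4), ?_, ?_⟩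
  · have := sq_sub_div_two_le_bernKL (p := 0) (q := 3 / 4) (by simp) (by norm_num) (by norm_num)
    have : 0 < bernKL 0 (3 / 4) := lt_of_lt_of_le (by norm_num) this
    positivity
  · rintro L K m hL hK hm ⟨q, rfl⟩
    have hq : 0 < q := Nat.pos_of_mul_pos_left hL
    exact ⟨blockInstance m q K hm hq ⟨0, by omega⟩, blockInstance_isClustered _ _ _,
      blockInstance_D _ _ _ hK⟩

/-! ### Path probabilities and conditional expectations -/

namespace Instance

variable {L K m : ℕ} (I : Instance L K m)

/-- The probability of the reward `y` of arm `k` in context `s`. -/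
def rewardProb (s : Fin L) (k : Fin K) (y : Bool) : ℝ :=
  if y = true then I.U s k else 1 - I.U s k

theorem rewardProb_nonneg (s : Fin L) (k : Fin K) (y : Bool) : 0 ≤ I.rewardProb s k y := by
  have := I.U_mem s k
  unfold rewardProb
  split_ifs
  exacts [this.1, sub_nonneg.2 this.2]

theorem sum_rewardProb (s : Fin L) (k : Fin K) : ∑ y, I.rewardProb s k y = 1 := by
  simp [rewardProb]

end Instance

namespace Policy

variable {L K m : ℕ} (π : Policy L K) (I : Instance L K m)

theorem pathProb_nonneg {T : ℕ} (h : Fin T → Round L K) : 0 ≤ π.pathProb I h :=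
  Finset.prod_nonneg fun _ _ => mul_nonneg (π.prob_nonneg _ _ _ _) (I.rewardProb_nonneg _ _ _)

theorem pathProb_snoc {T : ℕ} (h : Fin T → Round L K) (r : Round L K) :
    π.pathProb I (Fin.snoc h r : Fin (T + 1) → Round L K)
      = π.pathProb I h * (π.prob T h r.1 r.2.1 * I.rewardProb r.1 r.2.1 r.2.2) := by
  have e : ∀ j : Fin T, (Fin.snoc h r : Fin (T + 1) → Round L K) j.castSucc = h j := fun j =>
    Fin.snoc_castSucc (α := fun _ => Round L K) r h j
  have e' : (Fin.snoc h r : Fin (T + 1) → Round L K) (Fin.last T) = r :=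
    Fin.snoc_last (α := fun _ => Round L K) r h
  rw [pathProb, Fin.prod_univ_castSucc, e']
  congr 1
  · refine Finset.prod_congr rfl fun t _ => ?_
    rw [e]
    congr 2
    ext1 j
    exact e (Fin.castLE t.isLt.le j)
  · congr 2
    ext1 j
    exact e j

theorem mkHist_snoc {T : ℕ} (σ : Fin (T + 1) → Fin L) (x : Fin T → Fin K × Bool)
    (r : Fin K × Bool) :
    mkHist σ (Fin.snoc x r : Fin (T + 1) → Fin K × Bool)
      = (Fin.snoc (mkHist (Fin.init σ) x) (σ (Fin.last T), r) : Fin (T + 1) → Round L K) := by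
  ext1 t
  induction t using Fin.lastCases with
  | last => simp [mkHist]
  | cast j => simp [mkHist, Fin.init]

/-- Tower property: the last round is integrated first. Inductions on the horizon rest on it. -/
theorem condExp_succ {T : ℕ} (σ : Fin (T + 1) → Fin L) (f : (Fin (T + 1) → Round L K) → ℝ) :
    π.condExp I σ f = π.condExp I (Fin.init σ) fun h => ∑ r : Fin K × Bool,
      π.prob T h (σ (Fin.last T)) r.1 * I.rewardProb (σ (Fin.last T)) r.1 r.2 *
        f (Fin.snoc h (σ (Fin.last T), r) : Fin (T + 1) → Round L K) := by
  unfold condExp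
  rw [← (Fin.snocEquiv fun _ => Fin K × Bool).sum_comp, Fintype.sum_prod_type, Finset.sum_comm]
  refine Finset.sum_congr rfl fun x _ => ?_
  rw [Finset.mul_sum]
  refine Finset.sum_congr rfl fun r _ => ?_
  rw [show Fin.snocEquiv (fun _ => Fin K × Bool) (r, x)
    = (Fin.snoc x r : Fin (T + 1) → Fin K × Bool) from rfl, mkHist_snoc, pathProb_snoc]
  ring

theorem condExp_add {T : ℕ} (σ : Fin T → Fin L) (f g : (Fin T → Round L K) → ℝ) :
    π.condExp I σ (fun h => f h + g h) = π.condExp I σ f + π.condExp I σ g := by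
  simp only [condExp, mul_add, Finset.sum_add_distrib]

theorem condExp_mul_const {T : ℕ} (σ : Fin T → Fin L) (f : (Fin T → Round L K) → ℝ) (c : ℝ) :
    π.condExp I σ (fun h => f h * c) = π.condExp I σ f * c := by
  simp only [condExp, Finset.sum_mul, mul_assoc]

theorem condExp_sum {ι : Type*} (S : Finset ι) {T : ℕ} (σ : Fin T → Fin L)
    (f : ι → (Fin T → Round L K) → ℝ) :
    π.condExp I σ (fun h => ∑ i ∈ S, f i h) = ∑ i ∈ S, π.condExp I σ (f i) := by
  simp only [condExp, Finset.mul_sum]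
  exact Finset.sum_comm

theorem condExp_congr {T : ℕ} (σ : Fin T → Fin L) {f g : (Fin T → Round L K) → ℝ}
    (h : ∀ x, f (mkHist σ x) = g (mkHist σ x)) : π.condExp I σ f = π.condExp I σ g := by
  simp only [condExp, h]

theorem condExp_mono {T : ℕ} (σ : Fin T → Fin L) {f g : (Fin T → Round L K) → ℝ}
    (h : ∀ x, f (mkHist σ x) ≤ g (mkHist σ x)) : π.condExp I σ f ≤ π.condExp I σ g :=
  Finset.sum_le_sum fun _ _ => mul_le_mul_of_nonneg_left (h _) (π.pathProb_nonneg I _)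

theorem sum_prob_mul_rewardProb {T : ℕ} (h : Fin T → Round L K) (s : Fin L) :
    ∑ r : Fin K × Bool, π.prob T h s r.1 * I.rewardProb s r.1 r.2 = 1 := by
  rw [Fintype.sum_prod_type]
  simp only [← Finset.mul_sum, I.sum_rewardProb, mul_one, π.prob_sum]

theorem condExp_one {T : ℕ} (σ : Fin T → Fin L) : π.condExp I σ (fun _ => 1) = 1 := by
  induction T with
  | zero => simp [condExp, pathProb]
  | succ T ih =>
    rw [condExp_succ]
    simp only [mul_one, sum_prob_mul_rewardProb]
    exact ih _

theorem condExp_const {T : ℕ} (σ : Fin T → Fin L) (c : ℝ) : π.condExp I σ (fun _ => c) = c := by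
  simpa [condExp_one] using π.condExp_mul_const I σ (fun _ => 1) c

/-- Rewards can be integrated out of additive functionals of the history. -/
theorem condExp_sum_rounds (g : Round L K → ℝ) {T : ℕ} (σ : Fin T → Fin L) :
    π.condExp I σ (fun h => ∑ t, g (h t))
      = π.condExp I σ fun h =>
          ∑ t, ∑ y, I.rewardProb (h t).1 (h t).2.1 y * g ((h t).1, (h t).2.1, y) := by
  induction T with
  | zero => simp [condExp]
  | succ T ih =>
    -- Split off the last round; the earlier summands are unaffected because its arm and reward
    -- probabilities sum to one.
    have key : ∀ G : Round L K → ℝ, π.condExp I σ (fun h => ∑ t, G (h t))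
        = π.condExp I (Fin.init σ) (fun h => ∑ t, G (h t))
          + π.condExp I (Fin.init σ) (fun h => ∑ r : Fin K × Bool,
            π.prob T h (σ (Fin.last T)) r.1 * I.rewardProb (σ (Fin.last T)) r.1 r.2 *
              G (σ (Fin.last T), r)) := fun G => by
      rw [condExp_succ, ← condExp_add]
      congr 1
      ext1 h
      simp only [Fin.sum_univ_castSucc, Fin.snoc_castSucc, Fin.snoc_last, mul_add,
        Finset.sum_add_distrib, ← Finset.sum_mul, sum_prob_mul_rewardProb, one_mul]
    rw [key g, key fun r => ∑ y, I.rewardProb r.1 r.2.1 y * g (r.1, r.2.1, y), ih]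
    congr 2
    ext1 h
    rw [Fintype.sum_prod_type, Fintype.sum_prod_type]
    refine Finset.sum_congr rfl fun k _ => ?_
    simp only [mul_right_comm _ (I.rewardProb _ _ _), ← Finset.mul_sum, I.sum_rewardProb, mul_one,
      mul_assoc]
    exact congrArg _ (Finset.sum_congr rfl fun y _ => mul_comm _ _)

/-- The number of rounds in which the context lies in the cluster of `z i` and arm `k` is chosen. -/
def clusterPulls {T : ℕ} (i : Fin m) (k : Fin K) (h : Fin T → Round L K) : ℝ :=
  ∑ t : Fin T, if I.A (h t).1 i ≠ 0 ∧ (h t).2.1 = k then 1 else 0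

theorem sum_pulls {T : ℕ} (σ : Fin T → Fin L) (x : Fin T → Fin K × Bool) (s : Fin L) :
    ∑ k, pulls s k (mkHist σ x) = visits σ s := by
  unfold pulls visits mkHist
  rw [Finset.sum_comm]
  refine Finset.sum_congr rfl fun t _ => ?_
  by_cases h : σ t = s <;> simp [h]

theorem pulls_nonneg {T : ℕ} (s : Fin L) (k : Fin K) (h : Fin T → Round L K) : 0 ≤ pulls s k h :=
  Finset.sum_nonneg fun _ _ => by split_ifs <;> norm_num

theorem visits_nonneg {T : ℕ} (σ : Fin T → Fin L) (s : Fin L) : 0 ≤ visits σ s :=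
  Finset.sum_nonneg fun _ _ => by split_ifs <;> norm_num

theorem pulls_le_visits {T : ℕ} (σ : Fin T → Fin L) (x : Fin T → Fin K × Bool) (s : Fin L)
    (k : Fin K) : pulls s k (mkHist σ x) ≤ visits σ s := by
  rw [← sum_pulls σ x]
  exact Finset.single_le_sum (f := fun k => pulls s k (mkHist σ x))
    (fun _ _ => pulls_nonneg _ _ _) (Finset.mem_univ k)

end Policy

/-! ### The Bretagnolle–Huber inequality -/

/-- The Bretagnolle–Huber inequality on a finite type, for a test `φ` with values in `[0, 1]` and
a log-likelihood ratio `ℓ`. -/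
theorem bretagnolle_huber {X : Type*} [Fintype X] {p q ℓ φ : X → ℝ} (hp0 : ∀ x, 0 ≤ p x)
    (hp : ∑ x, p x = 1) (hq0 : ∀ x, 0 ≤ q x) (hq : ∑ x, q x = 1)
    (hpq : ∀ x, p x * Real.exp (-ℓ x) ≤ q x) (h0 : ∀ x, 0 ≤ φ x) (h1 : ∀ x, φ x ≤ 1) :
    Real.exp (-∑ x, p x * ℓ x) / 2 ≤ ∑ x, p x * φ x + ∑ x, q x * (1 - φ x) := by
  -- The error of any test is at least the overlap of the two laws; the rest bounds the overlap
  -- below.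
  have hmin : ∑ x, min (p x) (q x) ≤ ∑ x, p x * φ x + ∑ x, q x * (1 - φ x) := by
    rw [← Finset.sum_add_distrib]
    refine Finset.sum_le_sum fun x _ => ?_
    calc min (p x) (q x) = min (p x) (q x) * φ x + min (p x) (q x) * (1 - φ x) := by ring
      _ ≤ _ := add_le_add (mul_le_mul_of_nonneg_right (min_le_left _ _) (h0 x))
        (mul_le_mul_of_nonneg_right (min_le_right _ _) (sub_nonneg.2 (h1 x)))
  have hmax : ∑ x, max (p x) (q x) ≤ 2 := by
    calc ∑ x, max (p x) (q x) ≤ ∑ x, (p x + q x) :=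
          Finset.sum_le_sum fun x _ => max_le (by linarith [hq0 x]) (by linarith [hp0 x])
      _ = 2 := by rw [Finset.sum_add_distrib, hp, hq]; norm_num
  have hmin0 : 0 ≤ ∑ x, min (p x) (q x) := Finset.sum_nonneg fun x _ => le_min (hp0 x) (hq0 x)
  have hjensen : Real.exp (∑ x, p x * (-ℓ x / 2)) ≤ ∑ x, p x * Real.exp (-ℓ x / 2) := by
    simpa [smul_eq_mul] using convexOn_exp.map_sum_le (t := Finset.univ) (w := p)
      (p := fun x => -ℓ x / 2) (fun x _ => hp0 x) hp (fun x _ => Set.mem_univ _)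
  -- The left side is at most `√(p q)`, and `min * max = p q`. Cauchy–Schwarz then compares with the
  -- overlap.
  have hterm : ∀ x, p x * Real.exp (-ℓ x / 2) ≤ √(min (p x) (q x)) * √(max (p x) (q x)) := by
    intro x
    rw [← Real.sqrt_mul (le_min (hp0 x) (hq0 x)), min_mul_max]
    apply Real.le_sqrt_of_sq_le
    calc (p x * Real.exp (-ℓ x / 2)) ^ 2 = p x * (p x * Real.exp (-ℓ x)) := by
          rw [mul_pow, ← Real.exp_nat_mul]; push_cast; ring_nf
      _ ≤ p x * q x := mul_le_mul_of_nonneg_left (hpq x) (hp0 x)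
  have hcs : Real.exp (∑ x, p x * (-ℓ x / 2)) ≤ √(∑ x, min (p x) (q x)) * √2 :=
    calc Real.exp (∑ x, p x * (-ℓ x / 2))
        ≤ ∑ x, √(min (p x) (q x)) * √(max (p x) (q x)) :=
          hjensen.trans (Finset.sum_le_sum fun x _ => hterm x)
      _ ≤ √(∑ x, min (p x) (q x)) * √(∑ x, max (p x) (q x)) :=
          Real.sum_sqrt_mul_sqrt_le _ (fun x => le_min (hp0 x) (hq0 x))
            (fun x => (hp0 x).trans (le_max_left _ _))
      _ ≤ _ := mul_le_mul_of_nonneg_left (Real.sqrt_le_sqrt hmax) (Real.sqrt_nonneg _)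
  have hsq := pow_le_pow_left₀ (Real.exp_pos _).le hcs 2
  rw [mul_pow, Real.sq_sqrt hmin0, Real.sq_sqrt zero_le_two, ← Real.exp_nat_mul,
    show ((2 : ℕ) : ℝ) * ∑ x, p x * (-ℓ x / 2) = -∑ x, p x * ℓ x by
      rw [Finset.mul_sum, ← Finset.sum_neg_distrib]
      exact Finset.sum_congr rfl fun x _ => by push_cast; ring] at hsq
  linarith

theorem bernKL_self (p : ℝ) : bernKL p p = 0 := by
  have h : ∀ x : ℝ, Real.log (x / x) = 0 := fun x => by
    by_cases hx : x = 0 <;> simp [hx]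
  simp [bernKL, h]

/-! ### Raising one entry of `W` in a clustered instance -/

namespace Instance

variable {L K m : ℕ} (I : Instance L K m)

/-- Disjoint clusters and row sums one force row `s` of `A` to be a unit vector. -/
theorem mul_eq_of_mem_cluster (hI : I.IsClustered) (V : Matrix (Fin m) (Fin K) ℝ) {s : Fin L}
    {i : Fin m} (hs : s ∈ I.cluster i) (k : Fin K) : (I.A * V) s k = V i k := by
  have h0 : ∀ j, j ≠ i → I.A s j = 0 := fun j hj => by
    by_contra hc
    exact Set.disjoint_left.1 (hI.disjoint j i hj) hc hs
  have h1 : I.A s i = 1 := by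
    rw [← I.A_sum s, Finset.sum_eq_single i (fun j _ hj => h0 j hj) (by simp)]
  rw [Matrix.mul_apply, Finset.sum_eq_single i (fun j _ hj => by rw [h0 j hj, zero_mul])
    (by simp), h1, one_mul]

theorem eq_of_mem_cluster (hI : I.IsClustered) {s : Fin L} {i j : Fin m} (hi : s ∈ I.cluster i)
    (hj : s ∈ I.cluster j) : i = j := by
  by_contra h
  exact Set.disjoint_left.1 (hI.disjoint i j h) hi hj

theorem U_eq_W_of_mem_cluster (hI : I.IsClustered) {s : Fin L} {i : Fin m}
    (hs : s ∈ I.cluster i) (k : Fin K) : I.U s k = I.W i k :=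
  I.mul_eq_of_mem_cluster hI I.W hs k

/-- The instance in which the mean reward of arm `k` in the latent context `z i` is raised to
`λ`. -/
def raise (hI : I.IsClustered) (h : I.Umax < 1) (i : Fin m) (k : Fin K) : Instance L K m where
  β := I.β
  β_nonneg := I.β_nonneg
  β_sum := I.β_sum
  z := I.z
  A := I.A
  A_nonneg := I.A_nonneg
  A_sum := I.A_sum
  A_latent := I.A_latent
  W := Matrix.of fun i' k' => if i' = i ∧ k' = k then I.lam else I.W i' k'
  W_mem := fun i' k' => by
    simp only [Matrix.of_apply]
    split_ifs
    exacts [I.lam_mem, I.W_mem i' k']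
  exists_best := fun s => by
    obtain ⟨i', hi'⟩ := I.exists_mem_cluster s
    simp only [I.mul_eq_of_mem_cluster hI _ hi', Matrix.of_apply]
    -- In the raised cluster arm `k` wins because `λ > Umax`; in every other cluster the means are
    -- unchanged.
    by_cases hii : i' = i
    · refine ⟨k, fun j hj => ?_⟩
      simpa [hii, hj] using (I.W_le_Umax i j).trans_lt (I.Umax_lt_lam h)
    · refine ⟨I.bestArm s, fun j hj => ?_⟩
      simp only [hii, false_and, if_false, ← I.U_eq_W_of_mem_cluster hI hi']
      exact I.U_lt_bestMean hj

section raise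

variable (hI : I.IsClustered) (h : I.Umax < 1) (i : Fin m) (k : Fin K)

theorem isRaise_raise {i : Fin m} {k : Fin K} (hk : k ≠ I.bestArm (I.z i)) :
    I.IsRaise (I.raise hI h i k) :=
  ⟨rfl, rfl, rfl, i, k, hk, fun _ _ => rfl⟩

theorem raise_U (s : Fin L) (k' : Fin K) : (I.raise hI h i k).U s k'
    = if I.A s i ≠ 0 ∧ k' = k then I.lam else I.U s k' := by
  obtain ⟨i', hi'⟩ := I.exists_mem_cluster s
  have e : (I.raise hI h i k).U s k' = if i' = i ∧ k' = k then I.lam else I.W i' k' :=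
    I.mul_eq_of_mem_cluster hI (Matrix.of fun i' k' => if i' = i ∧ k' = k then I.lam else I.W i' k')
      hi' k'
  have e2 : I.A s i ≠ 0 ↔ i' = i :=
    ⟨fun h' => I.eq_of_mem_cluster hI hi' h', fun h' => h' ▸ hi'⟩
  rw [e, I.U_eq_W_of_mem_cluster hI hi']
  simp only [e2]

theorem raise_bestArm : (I.raise hI h i k).bestArm (I.z i) = k :=
  bestArm_eq _ fun j hj => by
    have hz : I.A (I.z i) i ≠ 0 := I.z_mem_cluster i
    simp only [raise_U, hz, hj, ne_eq, not_false_eq_true, and_false, and_self, if_true, if_false]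
    exact (I.U_le_Umax _ _).trans_lt (I.Umax_lt_lam h)

end raise

end Instance

/-! ### Change of measure for a policy -/

namespace Policy

variable {L K m : ℕ} (π : Policy L K) (I : Instance L K m)

/-- The policy's factors agree in both instances, so the likelihood ratio is a product of reward
ratios. The hypothesis on the means makes each reward possible under `I` possible under `J`; only an
inequality holds, since a path may be null under `I` alone. -/
theorem pathProb_mul_exp_le (J : Instance L K m)
    (hU : ∀ s k, I.U s k = J.U s k ∨ J.U s k ∈ Set.Ioo (0 : ℝ) 1) {T : ℕ}
    (h : Fin T → Round L K) :
    π.pathProb I h * Real.exp (-∑ t, Real.log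
      (I.rewardProb (h t).1 (h t).2.1 (h t).2.2 / J.rewardProb (h t).1 (h t).2.1 (h t).2.2))
      ≤ π.pathProb J h := by
  rw [← Finset.sum_neg_distrib, Real.exp_sum, pathProb, pathProb, ← Finset.prod_mul_distrib]
  refine Finset.prod_le_prod (fun t _ => mul_nonneg (mul_nonneg (π.prob_nonneg _ _ _ _)
    (I.rewardProb_nonneg _ _ _)) (Real.exp_pos _).le) fun t _ => ?_
  rw [mul_assoc]
  refine mul_le_mul_of_nonneg_left ?_ (π.prob_nonneg _ _ _ _)
  generalize (h t).1 = s
  generalize (h t).2.1 = k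
  generalize (h t).2.2 = y
  change I.rewardProb s k y * _ ≤ J.rewardProb s k y
  rcases (I.rewardProb_nonneg s k y).eq_or_lt with h0 | h0
  · rw [← h0, zero_mul]
    exact J.rewardProb_nonneg s k y
  have hJ : 0 < J.rewardProb s k y := by
    rcases hU s k with hs | hs
    · unfold Instance.rewardProb at h0 ⊢
      rwa [← hs]
    · unfold Instance.rewardProb
      split_ifs
      exacts [hs.1, sub_pos.2 hs.2]
  rw [Real.exp_neg, Real.exp_log (div_pos h0 hJ), inv_div, mul_div_cancel₀ _ h0.ne']

/-- The Bretagnolle–Huber inequality for two bandit instances, with the Kullback–Leibler divergence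
written as a sum over rounds. -/
theorem exp_neg_condExp_le (J : Instance L K m)
    (hU : ∀ s k, I.U s k = J.U s k ∨ J.U s k ∈ Set.Ioo (0 : ℝ) 1) {T : ℕ} (σ : Fin T → Fin L)
    (φ : (Fin T → Round L K) → ℝ) (h0 : ∀ x, 0 ≤ φ (mkHist σ x)) (h1 : ∀ x, φ (mkHist σ x) ≤ 1) :
    Real.exp (-π.condExp I σ fun h =>
      ∑ t, bernKL (I.U (h t).1 (h t).2.1) (J.U (h t).1 (h t).2.1)) / 2
      ≤ π.condExp I σ φ + π.condExp J σ fun h => 1 - φ h := by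
  -- The log-likelihood ratio is additive over rounds; integrating out the rewards turns each
  -- summand into a Bernoulli divergence.
  have e := π.condExp_sum_rounds I
    (fun r => Real.log (I.rewardProb r.1 r.2.1 r.2.2 / J.rewardProb r.1 r.2.1 r.2.2)) σ
  have e2 : (fun h : Fin T → Round L K =>
      ∑ t, bernKL (I.U (h t).1 (h t).2.1) (J.U (h t).1 (h t).2.1))
      = fun h => ∑ t, ∑ y, I.rewardProb (h t).1 (h t).2.1 y *
        Real.log (I.rewardProb (h t).1 (h t).2.1 y / J.rewardProb (h t).1 (h t).2.1 y) := by
    ext1 h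
    simp [bernKL, Instance.rewardProb]
  rw [e2, ← e]
  refine bretagnolle_huber (p := fun x => π.pathProb I (mkHist σ x))
    (q := fun x => π.pathProb J (mkHist σ x)) (φ := fun x => φ (mkHist σ x))
    (fun _ => π.pathProb_nonneg _ _) ?_ (fun _ => π.pathProb_nonneg _ _) ?_
    (fun x => π.pathProb_mul_exp_le I J hU _) h0 h1
  · simpa [condExp] using π.condExp_one I σ
  · simpa [condExp] using π.condExp_one J σ

theorem ConsistentAt.mono {π : Policy L K} {I : Instance L K m} {α C C' τ τ' : ℝ}
    (h : π.ConsistentAt I α C τ) (hC : C ≤ C') (hτ : τ ≤ τ') : π.ConsistentAt I α C' τ' :=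
  fun T σ s k hk hv => (h T σ s k hk (hτ.trans hv)).trans
    (mul_le_mul_of_nonneg_right hC (Real.rpow_nonneg (visits_nonneg σ s) α))

/-- The test is the fraction of visits to `z i` at which `k` is pulled. Its errors concern `z i`
alone and are controlled by consistency, while the divergence counts pulls of `k` in the whole
cluster. -/
theorem log_visits_le_clusterPulls (hI : I.IsClustered) (hU : I.Umax < 1) {α C τ : ℝ}
    (hC : 0 < C) (i : Fin m) {k : Fin K} (hk : k ≠ I.bestArm (I.z i))
    (h : π.ConsistentAt I α C τ) (h' : π.ConsistentAt (I.raise hI hU i k) α C τ) {T : ℕ}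
    (σ : Fin T → Fin L) (hv : τ ≤ visits σ (I.z i)) (hv0 : 0 < visits σ (I.z i)) :
    (1 - α) * Real.log (visits σ (I.z i)) - Real.log (2 * K * C)
      ≤ π.condExp I σ (clusterPulls I i k) * bernKL (I.W i k) I.lam := by
  set V := visits σ (I.z i) with hV
  set J := I.raise hI hU i k with hJ
  have hK : (0 : ℝ) < K := by exact_mod_cast k.pos
  have hBH := π.exp_neg_condExp_le I J (fun s k' => by
      rw [I.raise_U hI hU i k]
      split_ifs
      · exact Or.inr ⟨I.lam_pos, I.lam_lt_one hU⟩
      · exact Or.inl rfl) σ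
    (fun h => pulls (I.z i) k h * V⁻¹) (fun x => mul_nonneg (pulls_nonneg _ _ _)
      (inv_nonneg.2 hv0.le)) (fun x => by
        rw [← div_eq_mul_inv]
        exact div_le_one_of_le₀ (pulls_le_visits σ x _ _) hv0.le)
  have e1 : (π.condExp I σ fun h => ∑ t, bernKL (I.U (h t).1 (h t).2.1) (J.U (h t).1 (h t).2.1))
      = π.condExp I σ (clusterPulls I i k) * bernKL (I.W i k) I.lam := by
    rw [← condExp_mul_const]
    congr 1
    ext1 h
    rw [clusterPulls, Finset.sum_mul]
    refine Finset.sum_congr rfl fun t _ => ?_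
    rw [I.raise_U hI hU i k]
    split_ifs with hc
    · rw [one_mul, I.U_eq_W_of_mem_cluster hI hc.1, hc.2]
    · rw [bernKL_self, zero_mul]
  -- The second error is the fraction of visits to other arms, all suboptimal at `z i` in the raised
  -- instance.
  have e2 : (π.condExp J σ fun h => 1 - pulls (I.z i) k h * V⁻¹)
      = (∑ k' ∈ Finset.univ.erase k, π.condExp J σ (pulls (I.z i) k')) * V⁻¹ := by
    rw [← condExp_sum, ← condExp_mul_const]
    refine π.condExp_congr J σ fun x => ?_
    rw [← sub_eq_of_eq_add' (Finset.add_sum_erase _ (fun k' => pulls (I.z i) k' (mkHist σ x))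
      (Finset.mem_univ k)).symm, sum_pulls, sub_mul, ← hV, mul_inv_cancel₀ hv0.ne']
  rw [e1, e2, condExp_mul_const, ← add_mul] at hBH
  have b1 : π.condExp I σ (pulls (I.z i) k) ≤ C * V ^ α := h T σ _ k hk hv
  have b2 : ∀ k' ∈ Finset.univ.erase k, π.condExp J σ (pulls (I.z i) k') ≤ C * V ^ α :=
    fun k' hk' => h' T σ _ k' (by
      rw [I.raise_bestArm hI hU i k]
      exact Finset.ne_of_mem_erase hk') hv
  have b3 := Finset.sum_le_sum b2
  rw [Finset.sum_const, Finset.card_erase_of_mem (Finset.mem_univ k), Finset.card_univ,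
    Fintype.card_fin, nsmul_eq_mul, Nat.cast_sub k.pos, Nat.cast_one] at b3
  -- One arm under `I` and `K - 1` arms under `J` each contribute `C * V ^ (α - 1)`; the `2` is from
  -- Bretagnolle–Huber.
  have b4 : Real.exp (-(π.condExp I σ (clusterPulls I i k) * bernKL (I.W i k) I.lam))
      ≤ 2 * K * C * V ^ (α - 1) := by
    have := hBH.trans (mul_le_mul_of_nonneg_right (add_le_add b1 b3) (inv_nonneg.2 hv0.le))
    rw [Real.rpow_sub_one hv0.ne', div_eq_mul_inv]
    linarith
  have b5 := (Real.le_log_iff_exp_le (by positivity)).2 b4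
  rw [Real.log_mul (by positivity) (by positivity), Real.log_rpow hv0] at b5
  linarith

end Policy

/-! ### From pulls to regret -/

namespace Policy

variable {L K m : ℕ} (π : Policy L K) (I : Instance L K m)

theorem condExp_regret {T : ℕ} (σ : Fin T → Fin L) :
    (π.condExp I σ fun h => ∑ t, (I.bestMean (h t).1 - if (h t).2.2 = true then 1 else 0))
      = π.condExp I σ fun h => ∑ t, (I.bestMean (h t).1 - I.U (h t).1 (h t).2.1) := by
  rw [π.condExp_sum_rounds I fun r => I.bestMean r.1 - if r.2.2 = true then 1 else 0]
  congr 1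
  ext1 h
  refine Finset.sum_congr rfl fun t _ => ?_
  simp only [Fintype.sum_bool, Instance.rewardProb, if_true, Bool.false_eq_true, if_false]
  ring

theorem prod_β_nonneg {T : ℕ} (σ : Fin T → Fin L) : 0 ≤ ∏ t, I.β (σ t) :=
  Finset.prod_nonneg fun _ _ => I.β_nonneg _

theorem regret_nonneg (T : ℕ) : 0 ≤ π.regret I T := by
  refine Finset.sum_nonneg fun σ _ => mul_nonneg (prod_β_nonneg I σ) ?_
  rw [condExp_regret, ← π.condExp_const I σ 0]
  exact π.condExp_mono I σ fun x => Finset.sum_nonneg fun t _ =>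
    sub_nonneg.2 (I.U_le_bestMean _ _)

/-- Each context lies in exactly one cluster, so a round enters at most one term on the left. Its
means are those of `z i`, hence a suboptimal pull loses at least `gapAt (z i)`. -/
theorem sum_gap_mul_clusterPulls_le (hI : I.IsClustered) {T : ℕ} (h : Fin T → Round L K) :
    ∑ i, ∑ k ∈ Finset.univ.erase (I.bestArm (I.z i)), clusterPulls I i k h * I.gapAt (I.z i)
      ≤ ∑ t, (I.bestMean (h t).1 - I.U (h t).1 (h t).2.1) := by
  have e : ∑ i, ∑ k ∈ Finset.univ.erase (I.bestArm (I.z i)), clusterPulls I i k h * I.gapAt (I.z i)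
      = ∑ t, ∑ i, ∑ k ∈ Finset.univ.erase (I.bestArm (I.z i)),
        (if I.A (h t).1 i ≠ 0 ∧ (h t).2.1 = k then 1 else 0) * I.gapAt (I.z i) := by
    simp only [clusterPulls, Finset.sum_mul]
    rw [Finset.sum_comm]
    exact Finset.sum_congr rfl fun i _ => Finset.sum_comm
  rw [e]
  refine Finset.sum_le_sum fun t _ => ?_
  generalize (h t).1 = s
  generalize (h t).2.1 = x
  obtain ⟨i, hi⟩ := I.exists_mem_cluster s
  have hA : ∀ j, I.A s j ≠ 0 ↔ j = i := fun j =>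
    ⟨fun hj => I.eq_of_mem_cluster hI hj hi, fun hj => hj ▸ hi⟩
  rw [Finset.sum_eq_single i (fun j _ hj => Finset.sum_eq_zero fun k _ => by
    rw [if_neg (fun hc => hj ((hA j).1 hc.1)), zero_mul]) (by simp)]
  by_cases hx : x = I.bestArm (I.z i)
  · rw [Finset.sum_eq_zero fun k hk => by
      rw [if_neg (fun hc => Finset.ne_of_mem_erase hk (hc.2.symm.trans hx)), zero_mul]]
    exact sub_nonneg.2 (I.U_le_bestMean s x)
  · rw [Finset.sum_eq_single_of_mem x (Finset.mem_erase.2 ⟨hx, Finset.mem_univ x⟩)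
      (fun k _ hk => by rw [if_neg (fun hc => hk hc.2.symm), zero_mul]), if_pos ⟨hi, rfl⟩, one_mul]
    refine (I.gapAt_le hx).trans ?_
    have := I.U_le_bestMean s (I.bestArm (I.z i))
    rw [Instance.bestMean, I.U_latent, I.U_latent, I.U_eq_W_of_mem_cluster hI hi]
    rw [I.U_eq_W_of_mem_cluster hI hi] at this
    linarith

/-- Bounding `gapAt (z i)` below by `D * KL` turns the cost of the pulls into `D` times the
divergence, which is at least the logarithm. Latent contexts visited fewer than `v` times are
bounded by zero. -/
theorem sum_visits_le_condExp_regret (hK : 2 ≤ K) (hI : I.IsClustered) (hU : I.Umax < 1)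
    {α C v : ℝ} (hα : α < 1) (hC : 0 < C) (hv : 0 < v)
    (h : π.ConsistentAt I α C v)
    (h' : ∀ i k, k ≠ I.bestArm (I.z i) → π.ConsistentAt (I.raise hI hU i k) α C v) {T : ℕ}
    (σ : Fin T → Fin L) :
    ∑ i, (if v ≤ visits σ (I.z i) then 1 else 0) *
        (((K : ℝ) - 1) * (I.D * ((1 - α) * Real.log v - Real.log (2 * K * C))))
      ≤ π.condExp I σ fun h =>
          ∑ t, (I.bestMean (h t).1 - if (h t).2.2 = true then 1 else 0) := by
  rw [condExp_regret]
  refine le_trans ?_ (π.condExp_mono I σ (f := fun h => ∑ i,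
    ∑ k ∈ Finset.univ.erase (I.bestArm (I.z i)), clusterPulls I i k h * I.gapAt (I.z i))
    fun x => sum_gap_mul_clusterPulls_le I hI _)
  rw [condExp_sum]
  refine Finset.sum_le_sum fun i _ => ?_
  rw [condExp_sum]
  have hcard : (((Finset.univ.erase (I.bestArm (I.z i))).card : ℕ) : ℝ) = (K : ℝ) - 1 := by
    rw [Finset.card_erase_of_mem (Finset.mem_univ _), Finset.card_univ, Fintype.card_fin,
      Nat.cast_sub (by omega), Nat.cast_one]
  rw [← hcard, ← nsmul_eq_mul, mul_smul_comm]
  refine Finset.card_nsmul_le_sum _ _ _ fun k hk => ?_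
  have hk' := Finset.ne_of_mem_erase hk
  rw [condExp_mul_const]
  have hcp : 0 ≤ π.condExp I σ (clusterPulls I i k) := by
    rw [← π.condExp_const I σ 0]
    exact π.condExp_mono I σ fun x => Finset.sum_nonneg fun _ _ => by split_ifs <;> norm_num
  split_ifs with hvis
  · have h1 := π.log_visits_le_clusterPulls I hI hU hC i hk' h (h' i k hk') σ hvis
      (hv.trans_le hvis)
    have h2 := mul_le_mul_of_nonneg_left (Real.log_le_log hv hvis) (sub_nonneg.2 hα.le)
    have h3 := I.D_mul_bernKL_le hU i hk'
    calc 1 * (I.D * ((1 - α) * Real.log v - Real.log (2 * K * C)))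
        ≤ I.D * (π.condExp I σ (clusterPulls I i k) * bernKL (I.W i k) I.lam) := by
          rw [one_mul]
          exact mul_le_mul_of_nonneg_left (by linarith) I.D_nonneg
      _ = π.condExp I σ (clusterPulls I i k) * (I.D * bernKL (I.W i k) I.lam) := by ring
      _ ≤ _ := mul_le_mul_of_nonneg_left h3 hcp
  · rw [zero_mul]
    exact mul_nonneg hcp (I.gapAt_nonneg _)

/-- A Chernoff bound for the number of visits of a context under uniform contexts. -/
theorem one_sub_exp_le_prob_visits (hβ : ∀ s, I.β s = 1 / (L : ℝ)) (T : ℕ) (s : Fin L) :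
    1 - Real.exp (-((T : ℝ) / (8 * L)))
      ≤ ∑ σ : Fin T → Fin L, (∏ t, I.β (σ t)) *
          (if (T : ℝ) / (2 * L) ≤ visits σ s then 1 else 0) := by
  have hL : (0 : ℝ) < L := by exact_mod_cast I.L_pos
  have htot : ∑ σ : Fin T → Fin L, ∏ t, I.β (σ t) = 1 := by
    rw [← Fintype.sum_pow, I.β_sum, one_pow]
  -- Chernoff's method with parameter `-1`; by independence the transform is a `T`-th power.
  have hmgf : ∑ σ : Fin T → Fin L, (∏ t, I.β (σ t)) * Real.exp (-visits σ s)
      = (1 - (1 - Real.exp (-1)) / L) ^ T := by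
    have e : ∑ a, I.β a * Real.exp (-(if a = s then 1 else 0)) = 1 - (1 - Real.exp (-1)) / L := by
      have e1 : ∀ a, I.β a * Real.exp (-(if a = s then 1 else 0))
          = I.β a - if a = s then (1 - Real.exp (-1)) / L else 0 := fun a => by
        split_ifs
        · rw [hβ]; ring
        · simp
      rw [Finset.sum_congr rfl fun a _ => e1 a, Finset.sum_sub_distrib, I.β_sum,
        Finset.sum_ite_eq' Finset.univ s, if_pos (Finset.mem_univ s)]
    rw [← e, Fintype.sum_pow]
    refine Finset.sum_congr rfl fun σ _ => ?_
    rw [visits, ← Finset.sum_neg_distrib, Real.exp_sum, ← Finset.prod_mul_distrib]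
  -- This yields the rate `5/8`, and `5/8 - 1/2 = 1/8` is the exponent claimed.
  have hexp1 : Real.exp (-1) ≤ 3 / 8 := by
    rw [Real.exp_neg, inv_le_comm₀ (Real.exp_pos _) (by norm_num)]
    have := Real.exp_one_gt_d9
    norm_num at this ⊢
    linarith
  have hpow : (1 - (1 - Real.exp (-1)) / L) ^ T ≤ Real.exp (-(5 / 8 * (T / L))) := by
    have hL1 : (1 : ℝ) ≤ L := by exact_mod_cast I.L_pos
    have h0 : 0 ≤ 1 - (1 - Real.exp (-1)) / L := by
      rw [sub_nonneg, div_le_one hL]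
      linarith [Real.exp_pos (-1)]
    have h1 : 1 - (1 - Real.exp (-1)) / L ≤ Real.exp (-(5 / 8 / L)) := by
      have h2 := Real.add_one_le_exp (-(5 / 8 / (L : ℝ)))
      have h3 : 5 / 8 / (L : ℝ) ≤ (1 - Real.exp (-1)) / L :=
        div_le_div_of_nonneg_right (by linarith) hL.le
      linarith
    calc _ ≤ Real.exp (-(5 / 8 / L)) ^ T := pow_le_pow_left₀ h0 h1 T
      _ = _ := by rw [← Real.exp_nat_mul]; congr 1; ring
  -- Markov's inequality pointwise: the indicator of too few visits is at most `exp (T / (2L) -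
  -- visits)`.
  have hpt : ∀ σ : Fin T → Fin L, (∏ t, I.β (σ t)) - (∏ t, I.β (σ t)) * Real.exp (-visits σ s) *
      Real.exp ((T : ℝ) / (2 * L))
      ≤ (∏ t, I.β (σ t)) * (if (T : ℝ) / (2 * L) ≤ visits σ s then 1 else 0) := fun σ => by
    rw [mul_assoc, ← Real.exp_add, ← mul_one_sub]
    refine mul_le_mul_of_nonneg_left ?_ (prod_β_nonneg I σ)
    split_ifs with hc
    · linarith [Real.exp_pos (-visits σ s + (T : ℝ) / (2 * L))]
    · rw [sub_nonpos]
      exact Real.one_le_exp (by linarith)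
  have hsum := Finset.sum_le_sum fun σ (_ : σ ∈ Finset.univ) => hpt σ
  rw [Finset.sum_sub_distrib, ← Finset.sum_mul, htot, hmgf] at hsum
  refine le_trans ?_ hsum
  have h4 : Real.exp (-((T : ℝ) / (8 * L)))
      = Real.exp (-(5 / 8 * (T / L))) * Real.exp ((T : ℝ) / (2 * L)) := by
    rw [← Real.exp_add]
    congr 1
    field_simp
    ring
  rw [h4]
  exact sub_le_sub_left (mul_le_mul_of_nonneg_right hpow (Real.exp_pos _).le) 1

/-- No threshold on `T` beyond positivity is needed: where the bracket is negative, regret is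
nonnegative anyway, and where it is not, `T / (2L)` already exceeds the consistency threshold `C`.
The factor `exp 4` pays for the failure of the Chernoff event. -/
theorem regret_lower_bound (hK : 2 ≤ K) (hI : I.IsClustered) {α : ℝ} (hα : α ∈ Set.Ioo (0 : ℝ) 1)
    {C : ℝ} (hC : 1 ≤ C) (h : π.ConsistentAt I α C C)
    (h' : ∀ (hU : I.Umax < 1) i k, k ≠ I.bestArm (I.z i) →
      π.ConsistentAt (I.raise hI hU i k) α C C) {T : ℕ} (hT : 0 < T) :
    ((K : ℝ) - 1) * m * I.D *
        ((1 - α) * (Real.log ((T : ℝ) / (2 * m)) - Real.log ((L : ℝ) / m))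
          - Real.log (4 * K * (Real.exp 4 * C)))
      ≤ π.regret I T := by
  rcases I.Umax_le_one.eq_or_lt with hU | hU
  · rw [I.D_eq_zero hK hU, mul_zero, zero_mul]
    exact π.regret_nonneg I T
  have hL : (0 : ℝ) < L := by exact_mod_cast I.L_pos
  have hm : (0 : ℝ) < m := by exact_mod_cast I.m_pos
  have hT' : (0 : ℝ) < T := by exact_mod_cast hT
  have hK' : (2 : ℝ) ≤ K := by exact_mod_cast hK
  have hC0 : 0 < C := by linarith
  set v : ℝ := (T : ℝ) / (2 * L) with hv
  have hv0 : 0 < v := by positivity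
  have elog : Real.log ((T : ℝ) / (2 * m)) - Real.log ((L : ℝ) / m) = Real.log v := by
    rw [← Real.log_div (by positivity) (by positivity)]
    congr 1
    rw [hv]
    field_simp
  have elog2 : Real.log (4 * K * (Real.exp 4 * C)) = Real.log 2 + 4 + Real.log (2 * K * C) := by
    rw [show 4 * K * (Real.exp 4 * C) = 2 * Real.exp 4 * (2 * K * C) by ring,
      Real.log_mul (by positivity) (by positivity), Real.log_mul (by positivity) (by positivity),
      Real.log_exp]
  have hlog2 := Real.log_pos one_lt_two
  have hKC : 1 ≤ 2 * K * C := by nlinarith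
  have hlogKC := Real.log_nonneg hKC
  rw [elog, elog2]
  set B := (1 - α) * Real.log v - Real.log (2 * K * C) with hB
  have hM : 0 ≤ ((K : ℝ) - 1) * m * I.D :=
    mul_nonneg (mul_nonneg (by linarith) hm.le) I.D_nonneg
  rcases le_total ((1 - α) * Real.log v - (Real.log 2 + 4 + Real.log (2 * K * C))) 0
    with hneg | hpos
  · exact (mul_nonpos_of_nonneg_of_nonpos hM hneg).trans (π.regret_nonneg I T)
  have hB0 : 0 ≤ B := by linarith
  have hlogv : 0 ≤ Real.log v := by
    by_contra hc
    push Not at hc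
    nlinarith [hα.2]
  have hBv : B ≤ Real.log v - Real.log (2 * K * C) := by
    nlinarith [mul_nonneg hα.1.le hlogv]
  -- A nonnegative bracket gives `log v ≥ log (2KC) ≥ log C`, so consistency applies from `v` visits
  -- on.
  have hCv : C ≤ v := by
    have h1 : Real.log C ≤ Real.log v := by
      have : Real.log C ≤ Real.log (2 * K * C) := Real.log_le_log hC0 (by nlinarith)
      linarith
    exact (Real.log_le_log_iff hC0 hv0).1 h1
  have hσ := fun σ : Fin T → Fin L => mul_le_mul_of_nonneg_left
    (π.sum_visits_le_condExp_regret I hK hI hU hα.2 hC0 hv0 (h.mono le_rfl hCv)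
      (fun i k hk => (h' hU i k hk).mono le_rfl hCv) σ) (prod_β_nonneg I σ)
  have hsum := Finset.sum_le_sum fun σ (_ : σ ∈ Finset.univ) => hσ σ
  change _ ≤ π.regret I T at hsum
  refine le_trans ?_ hsum
  simp only [Finset.mul_sum, ← mul_assoc]
  rw [Finset.sum_comm]
  have hi : ∀ i ∈ (Finset.univ : Finset (Fin m)),
      (1 - Real.exp (-((T : ℝ) / (8 * L)))) * (((K : ℝ) - 1) * I.D * B)
      ≤ ∑ σ : Fin T → Fin L, (∏ t, I.β (σ t)) * (if v ≤ visits σ (I.z i) then 1 else 0) *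
        ((K : ℝ) - 1) * I.D * B := fun i _ => by
    have := mul_le_mul_of_nonneg_right (one_sub_exp_le_prob_visits I hI.uniform T (I.z i))
      (mul_nonneg (mul_nonneg (by linarith : (0 : ℝ) ≤ (K : ℝ) - 1) I.D_nonneg) hB0)
    rw [Finset.sum_mul] at this
    simpa only [← mul_assoc] using this
  refine le_trans ?_ (Finset.card_nsmul_le_sum _ _ _ hi)
  rw [Finset.card_univ, Fintype.card_fin, nsmul_eq_mul]
  -- The exponent is `v / 4`, and `B ≤ log v ≤ v ≤ 4 * exp (v / 4)`.
  have hfail : B * Real.exp (-((T : ℝ) / (8 * L))) ≤ 4 := by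
    have e8 : (T : ℝ) / (8 * L) = v / 4 := by rw [hv]; field_simp; norm_num
    rw [e8, Real.exp_neg, ← div_eq_mul_inv, div_le_iff₀ (Real.exp_pos _)]
    have h1 := Real.add_one_le_exp (v / 4)
    have h2 := Real.log_le_sub_one_of_pos hv0
    linarith
  calc ((K : ℝ) - 1) * m * I.D * ((1 - α) * Real.log v - (Real.log 2 + 4 + Real.log (2 * K * C)))
      ≤ ((K : ℝ) - 1) * m * I.D * (B - B * Real.exp (-((T : ℝ) / (8 * L)))) :=
        mul_le_mul_of_nonneg_left (by linarith) hM
    _ = _ := by ring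

/-- Constants of finitely many instances have a common bound, usable both as factor and as
threshold. The argument only involves `I` and its finitely many raises. -/
theorem IsConsistent.exists_consistentAt {π : Policy L K} {α : ℝ} (h : π.IsConsistent m α)
    {ι : Type*} [Finite ι] (J : ι → Instance L K m) :
    ∃ C : ℝ, 1 ≤ C ∧ ∀ i, π.ConsistentAt (J i) α C C := by
  choose C τ hC using h
  obtain ⟨M, hM⟩ := (Set.finite_range fun i => max 1 (max (C (J i)) (τ (J i)))).bddAbove
  have hM' : ∀ i, max 1 (max (C (J i)) (τ (J i))) ≤ M := fun i => hM ⟨i, rfl⟩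
  exact ⟨max 1 M, le_max_left _ _, fun i => (hC (J i)).mono
    (((le_max_left _ _).trans (le_max_right _ _)).trans ((hM' i).trans (le_max_right _ _)))
    (((le_max_right _ _).trans (le_max_right _ _)).trans ((hM' i).trans (le_max_right _ _)))⟩

end Policy

end LatentBandit
end

/-! ### Assembly -/

theorem mainTheorem4 :
    -- the class of instances is nonempty, with a value of `D` independent of `L`, `K`, `m`
    (∃ d : ℝ, 0 < d ∧ ∀ L K m : ℕ, 0 < L → 2 ≤ K → 0 < m → m ∣ L →
      ∃ I : LatentBandit.Instance L K m, I.IsClustered ∧ I.D = d) ∧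
    -- `D(U) = O(1 / Δ)`, and `D(U)` is positive unless some mean reward equals `1`
    (∃ c : ℝ, 0 < c ∧ ∀ (L K m : ℕ) (I : LatentBandit.Instance L K m), 2 ≤ K → I.IsClustered →
      I.D ≤ c / I.gap ∧ (I.Umax < 1 → 0 < I.D)) ∧
    -- the regret of every consistent policy on every instance of the class
    (∀ (L K m : ℕ) (I : LatentBandit.Instance L K m), 2 ≤ K → I.IsClustered →
      ∀ α ∈ Set.Ioo (0 : ℝ) 1, ∀ π : LatentBandit.Policy L K, π.IsConsistent m α →
        ∃ C τ : ℝ, 0 < C ∧ 0 ≤ τ ∧ ∀ T : ℕ, τ < (T : ℝ) →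
          ((K : ℝ) - 1) * m * I.D *
              ((1 - α) * (Real.log ((T : ℝ) / (2 * m)) - Real.log ((L : ℝ) / m))
                - Real.log (4 * K * C))
            ≤ π.regret I T) ∧
    -- `C` and `τ` depend only on the constants in the consistency bound
    (∀ C₀ τ₀ : ℝ, ∃ C τ : ℝ, 0 < C ∧ 0 ≤ τ ∧
      ∀ (L K m : ℕ) (I : LatentBandit.Instance L K m), 2 ≤ K → I.IsClustered →
      ∀ α ∈ Set.Ioo (0 : ℝ) 1, ∀ π : LatentBandit.Policy L K,
        π.ConsistentAt I α C₀ τ₀ → (∀ J, I.IsRaise J → π.ConsistentAt J α C₀ τ₀) →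
        ∀ T : ℕ, τ < (T : ℝ) →
          ((K : ℝ) - 1) * m * I.D *
              ((1 - α) * (Real.log ((T : ℝ) / (2 * m)) - Real.log ((L : ℝ) / m))
                - Real.log (4 * K * C))
            ≤ π.regret I T) := by
  open LatentBandit in
  refine ⟨exists_isClustered_D_eq, ⟨2, two_pos, fun L K m I hK _ =>
    ⟨I.D_le_two_div_gap hK, I.D_pos hK⟩⟩, fun L K m I hK hI α hα π hπ => ?_, fun C₀ τ₀ => ?_⟩
  · obtain ⟨C₁, h₁, hC₁⟩ := hπ.exists_consistentAt fun _ : Unit => I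
    obtain ⟨C₂, h₂, hC₂⟩ : ∃ C : ℝ, 1 ≤ C ∧ ∀ (hU : I.Umax < 1) i k,
        π.ConsistentAt (I.raise hI hU i k) α C C := by
      -- Raised instances exist only if `Umax < 1`; otherwise any constant serves.
      by_cases hU : I.Umax < 1
      · obtain ⟨C, hC, h⟩ := hπ.exists_consistentAt fun p : Fin m × Fin K => I.raise hI hU p.1 p.2
        exact ⟨C, hC, fun _ i k => h (i, k)⟩
      · exact ⟨1, le_rfl, fun h => absurd h hU⟩
    refine ⟨Real.exp 4 * max C₁ C₂, 0, by positivity, le_rfl, fun T hT => ?_⟩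
    exact π.regret_lower_bound I hK hI hα (h₁.trans (le_max_left _ _))
      ((hC₁ ()).mono (le_max_left _ _) (le_max_left _ _))
      (fun hU i k _ => (hC₂ hU i k).mono (le_max_right _ _) (le_max_right _ _))
      (by exact_mod_cast hT)
  · have hC := (le_max_left C₀ τ₀).trans (le_max_right 1 _)
    have hτ := (le_max_right C₀ τ₀).trans (le_max_right 1 _)
    refine ⟨Real.exp 4 * max 1 (max C₀ τ₀), 0, by positivity, le_rfl,
      fun L K m I hK hI α hα π h h' T hT => ?_⟩
    exact π.regret_lower_bound I hK hI hα (le_max_left _ _) (h.mono hC hτ)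
      (fun hU i k hk => (h' _ (I.isRaise_raise hI hU hk)).mono hC hτ) (by exact_mod_cast hT)
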